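/- Let $\Bbbk$ be a field and let $\mathcal S\subset\mathbb N^4$ be a simplicial affine semigroup (containing $0$) with minimal generating set $\{\mathbf a_1,\dots,\mathbf a_e\}$, $e\ge 4$, numbered so that $\mathbf a_1,\dots,\mathbf a_4$ are linearly independent over $\mathbb Q$, generate the rational cone $\{\sum_{j=1}^e q_j\mathbf a_j : q_j\in\mathbb Q_{\ge 0}\}$, and each $\mathbf a_i$ with $i\le 4$ is the componentwise smallest generator on its ray. Let $\Bbbk[\mathcal S]=\bigoplus_{\mathbf s\in\mathcal S}\Bbbk\,\mathbf t^{\mathbf s}$ be the semigroup ring and let $\operatorname{depth}\Bbbk[\mathcal S]$ be the maximal length of a regular sequence on $\Bbbk[\mathcal S]$ contained in the maximal ideal generated by the $\mathbf t^{\mathbf s}$, $\mathbf 0\ne\mathbf s\in\mathcal S$. For $\mathbf c\in\mathcal S$ put $\operatorname{Ap}(\mathcal S,\mathbf c)=\{\mathbf x\in\mathcal S:\mathbf x-\mathbf c\notin\mathcal S\}$, and order $\mathcal S$ by $\mathbf x\preceq_{\mathcal S}\mathbf y$ if and only if $\mathbf y-\mathbf x\in\mathcal S$; maximal elements are taken for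 this order. Then $\operatorname{depth}\Bbbk[\mathcal S]=2$ if and only if both of the following hold. (A) $\operatorname{Ap}(\mathcal S,\mathbf c)$ has no maximal element for some $\mathbf 0\neq\mathbf c\in\mathcal S$. (B) There are $\{i,j,k,l\}=\{1,2,3,4\}$ and $\mathbf b\in\operatorname{Ap}(\mathcal S,\mathbf a_i)\cap\operatorname{Ap}(\mathcal S,\mathbf a_j)$ such that (1) $\mathbf b+\mathbf a_k-\mathbf a_i$ and $\mathbf b+\mathbf a_l-\mathbf a_i$ belong to $\mathcal S$, or (2) $\mathbf b+\mathbf a_k-\mathbf a_i$, $\mathbf b+\mathbf a_l-\mathbf a_j$ and $\mathbf b+\mathbf a_k+\mathbf a_l-(\mathbf a_i+\mathbf a_j)$ belong to $\mathcal S$. The equivalence also holds with "for some $\mathbf 0\ne\mathbf c\in\mathcal S$" in (A) replaced by "for every $\mathbf 0\ne\mathbf c\in\mathcal S$". Moreover, whenever $\{i,j,k,l\}=\{1,2,3,4\}$ and $\mathbf b\in\operatorname{Ap}(\mathcal S,\mathbf a_i)\cap\operatorname{Ap}(\mathcal S,\mathbf a_j)$ satisfy (1) or (2), the set $\operatorname{Ap}(\mathcal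 S,\mathbf a_i)\cap\operatorname{Ap}(\mathcal S,\mathbf a_j)$ has a maximal element. -/

import Mathlib

namespace AffineSemigroup

/-- A vector of `ℕ^d`, seen in `ℚ^d`. -/
def toRat {d : ℕ} (v : Fin d → ℕ) : Fin d → ℚ := fun c => (v c : ℚ)

/-- A vector of `ℕ^d`, seen in `ℤ^d`. -/
def toInt {d : ℕ} (v : Fin d → ℕ) : Fin d → ℤ := fun c => (v c : ℤ)

/-- The rational cone `pos` of a finite family of vectors of `ℕ^d`: all linear combinations with
nonnegative rational coefficients. -/
def pos {d : ℕ} {ι : Type*} [Fintype ι] (a : ι → Fin d → ℕ) : Set (Fin d → ℚ) :=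
  {v | ∃ q : ι → ℚ, (∀ i, 0 ≤ q i) ∧ v = ∑ i, q i • toRat (a i)}

/-- The first `d` members of a family of `e ≥ d` vectors. -/
def extremal {d e : ℕ} (hde : d ≤ e) (a : Fin e → Fin d → ℕ) : Fin d → Fin d → ℕ :=
  fun i => a (Fin.castLE hde i)

/-- `a 0, …, a (e - 1)` is the minimal generating set of a simplicial affine semigroup in `ℕ^d`,
numbered so that the first `d` generators are the extremal rays: these are linearly independent
over `ℚ` (so the group generated by all the `a j` has rank `d`), they generate the whole cone, and
each of them is the componentwise smallest generator on its ray. -/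
structure IsSimplicialGenerators {d e : ℕ} (hde : d ≤ e) (a : Fin e → Fin d → ℕ) : Prop where
  minimal : ∀ j, a j ∉ AddSubmonoid.closure (a '' {j}ᶜ)
  linearIndependent : LinearIndependent ℚ fun i => toRat (extremal hde a i)
  pos_eq : pos a = pos (extremal hde a)
  smallest : ∀ (i : Fin d) (j : Fin e),
    (∃ q : ℚ, 0 ≤ q ∧ toRat (a j) = q • toRat (extremal hde a i)) → extremal hde a i ≤ a j

/-- The semigroup (with zero) generated by the vectors `a j ∈ ℕ^d`, as a submonoid of `ℤ^d`, so
that differences of its elements make sense. -/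
def semigroup {d e : ℕ} (a : Fin e → Fin d → ℕ) : AddSubmonoid (Fin d → ℤ) :=
  AddSubmonoid.closure (Set.range fun j => toInt (a j))

/-- The monomial maximal ideal of `𝕜[S]`, spanned by the monomials `t ^ s`, `0 ≠ s ∈ S`. -/
noncomputable def monomialIdeal (𝕜 : Type*) [Field 𝕜] {d : ℕ} (S : AddSubmonoid (Fin d → ℤ)) :
    Ideal (AddMonoidAlgebra 𝕜 S) :=
  Ideal.span {f | ∃ s : S, s ≠ 0 ∧ f = AddMonoidAlgebra.single s 1}

/-- The depth of `𝕜[S]`: the supremum of the lengths of the regular sequences on `𝕜[S]` whose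
members lie in the monomial maximal ideal. -/
noncomputable def depth (𝕜 : Type*) [Field 𝕜] {d : ℕ} (S : AddSubmonoid (Fin d → ℤ)) : ℕ∞ :=
  sSup {n | ∃ rs : List (AddMonoidAlgebra 𝕜 S), (∀ r ∈ rs, r ∈ monomialIdeal 𝕜 S) ∧
    RingTheory.Sequence.IsRegular (AddMonoidAlgebra 𝕜 S) rs ∧ n = (rs.length : ℕ∞)}

/-- The Apéry set `Ap(S, b)`. -/
def Ap {d : ℕ} (S : AddSubmonoid (Fin d → ℤ)) (b : Fin d → ℤ) : Set (Fin d → ℤ) :=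
  {x | x ∈ S ∧ x - b ∉ S}

/-- `X` has a maximal element for the order `x ⪯ y ↔ y - x ∈ S`. -/
def HasMaximal {d : ℕ} (S : AddSubmonoid (Fin d → ℤ)) (X : Set (Fin d → ℤ)) : Prop :=
  ∃ m ∈ X, ∀ x ∈ X, x - m ∈ S → x = m

/-- `b ∈ Ap(S, E i) ∩ Ap(S, E j)`, and `b + E k - E i`, `b + E l - E i` lie in `S`. -/
def CondOne {d : ℕ} (S : AddSubmonoid (Fin d → ℤ)) (E : Fin 4 → Fin d → ℤ) (i j k l : Fin 4)
    (b : Fin d → ℤ) : Prop :=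
  b ∈ Ap S (E i) ∩ Ap S (E j) ∧ b + E k - E i ∈ S ∧ b + E l - E i ∈ S

/-- `b ∈ Ap(S, E i) ∩ Ap(S, E j)`, and `b + E k - E i`, `b + E l - E j`,
`b + E k + E l - (E i + E j)` lie in `S`. -/
def CondTwo {d : ℕ} (S : AddSubmonoid (Fin d → ℤ)) (E : Fin 4 → Fin d → ℤ) (i j k l : Fin 4)
    (b : Fin d → ℤ) : Prop :=
  b ∈ Ap S (E i) ∩ Ap S (E j) ∧ b + E k - E i ∈ S ∧ b + E l - E j ∈ S ∧
    b + E k + E l - (E i + E j) ∈ S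

end AffineSemigroup

/-!
The elements `x i = t ^ (E i)`, `i : Fin 4`, generate an ideal of `𝕜[S]` whose radical contains the
monomial ideal `𝔪`, because all but finitely many elements of `S` lie in some `E i + S`
(`IsSimplicialGenerators.finite_iInter_ap`). The depth is therefore read off from the Koszul
cohomology `H^n` of `x`: a regular sequence of length `n + 1` in `𝔪` exists if and only if
`H^0, …, H^n` vanish (`exists_isRegular_two_le_iff`, `exists_isRegular_three_le_iff`). Only
`n ≤ 2` is needed, and there cocycles and coboundaries can be written out. In one direction, an
element of `𝔪` acts nilpotently on `H^n(M)`, and injectively if it is regular on `M` and `H^(n-1)`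
vanishes for the quotient (`koszulExactOne_of_quotSMulTop`, `koszulExactTwo_of_quotSMulTop`). In the
other, the vanishing of `H^n` and `H^(n+1)` for `M` gives that of `H^n` for the quotient, and prime
avoidance turns `H^0 = 0` into a regular element of `𝔪`
(`KoszulExactZero.exists_isSMulRegular`). Prime avoidance needs no assumption on the size of the
field; the price is that regular elements are not homogeneous, but only the cohomology of `𝕜[S]`
itself and of quotients by one monomial is ever computed.

These two computations are combinatorial. For `0 ≠ c ∈ S`, `H^1(𝕜[S]) = 0` if and only if
`H^0(𝕜[S] / (t ^ c)) = 0`, and if the latter is nonzero it contains the class of a monomial `t ^ v`,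
`v ∈ Ap(S, c)`, above which `Ap(S, c)` is finite and so has a maximal element
(`koszulExactZero_quotSMulTop_single_iff`). In degree `p ∈ ℤ^4`, a cocycle of degree two consists of
the differences `η j - η i` of scalars attached to the four indices, which must vanish unless
`p + E i + E j ∈ S`, and it bounds if and only if `η` is constant on the `i` with `p + E i ∉ S`.
For an obstruction `η i ≠ η j`, put `b = p + E i + E j`: `CondOne` and `CondTwo` are the ways in
which the two remaining indices can be distributed between `{η = η j}` and its complement
(`hasDegreeTwoClass_iff`).

The maximal element of `Ap(S, E i) ∩ Ap(S, E j)` comes from the same finiteness: either condition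
leaves only finitely many elements of this set above `b` (`hasMaximal_of_condOne_or_condTwo`).
-/

namespace AffineSemigroup

/-! ### Koszul cochains in degrees zero, one and two -/

section Koszul

variable {R ι : Type*} [CommRing R]

/-- The Koszul cochain complex of the family `x` with coefficients in `M` is exact in degree `0`. -/
def KoszulExactZero (x : ι → R) (M : Type*) [AddCommGroup M] [Module R M] : Prop :=
  ∀ m : M, (∀ i, x i • m = 0) → m = 0

/-- The Koszul cochain complex of the family `x` with coefficients in `M` is exact in degree `1`. -/
def KoszulExactOne (x : ι → R) (M : Type*) [AddCommGroup M] [Module R M] : Prop :=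
  ∀ y : ι → M, (∀ i j, x i • y j = x j • y i) → ∃ m, ∀ i, y i = x i • m

/-- The Koszul cochain complex of the family `x` with coefficients in `M` is exact in degree `2`.
A cochain of degree `2` is an alternating family indexed by pairs of indices. -/
def KoszulExactTwo (x : ι → R) (M : Type*) [AddCommGroup M] [Module R M] : Prop :=
  ∀ z : ι → ι → M, (∀ i, z i i = 0) → (∀ i j, z j i = -z i j) →
    (∀ i j k, x i • z j k - x j • z i k + x k • z i j = 0) →
    ∃ y : ι → M, ∀ i j, z i j = x i • y j - x j • y i

variable {M : Type*} [AddCommGroup M] [Module R M] {x : ι → R} {f : R}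

/-- If `f` acts injectively on `Z / B` and nilpotently, because the `x i` kill `Z / B` and `f` lies
in the radical of the ideal they span, then `Z / B` vanishes. -/
lemma mem_of_mem_radical {A : Type*} [AddCommGroup A] [Module R A] (Z B : Submodule R A)
    (hf : f ∈ (Ideal.span (Set.range x)).radical) (hx : ∀ z ∈ Z, ∀ i, x i • z ∈ B)
    (h : ∀ z ∈ Z, f • z ∈ B → z ∈ B) {z : A} (hz : z ∈ Z) : z ∈ B := by
  obtain ⟨n, hn⟩ := hf
  have key : ∀ r ∈ Ideal.span (Set.range x), r • z ∈ B := by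
    intro r hr
    induction hr using Submodule.span_induction with
    | mem r hr => obtain ⟨i, rfl⟩ := hr; exact hx z hz i
    | zero => simp
    | add r s _ _ hr hs => rw [add_smul]; exact B.add_mem hr hs
    | smul r s _ hs => rw [smul_eq_mul, mul_smul]; exact B.smul_mem r hs
  have hz' := key _ hn
  clear hn
  induction n with
  | zero => simpa using hz'
  | succ n ih =>
    refine ih (h _ (Z.smul_mem _ hz) ?_)
    rwa [smul_smul, ← pow_succ']

lemma quotSMulTop_mk_eq_zero {m : M} :
    (Submodule.Quotient.mk m : QuotSMulTop f M) = 0 ↔ ∃ u, f • u = m := by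
  rw [Submodule.Quotient.mk_eq_zero, Submodule.mem_smul_pointwise_iff_exists]
  simp

lemma koszulExactZero_of_isSMulRegular (hf : f ∈ (Ideal.span (Set.range x)).radical)
    (hreg : IsSMulRegular M f) : KoszulExactZero x M := by
  intro m hm
  let Z : Submodule R M :=
    { carrier := {m | ∀ i, x i • m = 0}
      add_mem' := fun {a b} ha hb i => by simp [ha i, hb i]
      zero_mem' := fun i => smul_zero _
      smul_mem' := fun c a ha i => by rw [smul_comm, ha i, smul_zero] }
  refine (Submodule.mem_bot R).1 (mem_of_mem_radical Z ⊥ hf (fun z hz i => ?_) (fun z _ h => ?_) hm)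
  · simpa using hz i
  · exact (Submodule.mem_bot R).2 (hreg.right_eq_zero_of_smul ((Submodule.mem_bot R).1 h))

/-- Multiplication by `f` on the first Koszul cohomology of `M` is injective when `M / f M` has no
cohomology in degree `0`; as it is also nilpotent, this cohomology vanishes. -/
lemma koszulExactOne_of_quotSMulTop (hf : f ∈ (Ideal.span (Set.range x)).radical)
    (hreg : IsSMulRegular M f) (h0 : KoszulExactZero x (QuotSMulTop f M)) :
    KoszulExactOne x M := by
  intro y hy
  let Z : Submodule R (ι → M) :=
    { carrier := {y | ∀ i j, x i • y j = x j • y i}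
      add_mem' := fun {a b} ha hb i j => by simp [ha i j, hb i j]
      zero_mem' := fun i j => by simp
      smul_mem' := fun c a ha i j => by
        simp only [Pi.smul_apply]; rw [smul_comm, ha i j, smul_comm] }
  let d : M →ₗ[R] (ι → M) := LinearMap.pi fun i => x i • LinearMap.id
  have hd : ∀ m i, d m i = x i • m := fun m i => rfl
  have hmem : y ∈ LinearMap.range d := by
    refine mem_of_mem_radical Z _ hf (fun z hz i => ?_) (fun z hz h => ?_) hy
    · exact ⟨z i, funext fun j => by rw [hd, Pi.smul_apply]; exact hz j i⟩
    · obtain ⟨m, hm⟩ := h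
      have hm' : ∀ i, x i • m = f • z i := fun i => congrFun hm i
      obtain ⟨u, rfl⟩ := quotSMulTop_mk_eq_zero.1 (h0 (Submodule.Quotient.mk m) fun i => by
        rw [← Submodule.Quotient.mk_smul, quotSMulTop_mk_eq_zero]
        exact ⟨z i, (hm' i).symm⟩)
      refine ⟨u, funext fun i => hreg ?_⟩
      change f • d u i = f • z i
      rw [hd, smul_comm, hm' i]
  obtain ⟨m, rfl⟩ := hmem
  exact ⟨m, fun i => rfl⟩

/-- Multiplication by `f` on the second Koszul cohomology of `M` is injective when `M / f M` has no
cohomology in degree `1`; as it is also nilpotent, this cohomology vanishes. -/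
lemma koszulExactTwo_of_quotSMulTop (hf : f ∈ (Ideal.span (Set.range x)).radical)
    (hreg : IsSMulRegular M f) (h1 : KoszulExactOne x (QuotSMulTop f M)) :
    KoszulExactTwo x M := by
  intro z hz0 hz1 hz2
  let Z : Submodule R (ι → ι → M) :=
    { carrier := {z | (∀ i, z i i = 0) ∧ (∀ i j, z j i = -z i j) ∧
        ∀ i j k, x i • z j k - x j • z i k + x k • z i j = 0}
      add_mem' := by
        rintro a b ⟨ha0, ha1, ha2⟩ ⟨hb0, hb1, hb2⟩
        refine ⟨fun i => by simp [ha0, hb0], fun i j => ?_, fun i j k => ?_⟩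
        · simp only [Pi.add_apply]; rw [ha1 i j, hb1 i j, neg_add]
        · have := congrArg₂ (· + ·) (ha2 i j k) (hb2 i j k)
          simp only [Pi.add_apply, smul_add, add_zero] at this ⊢
          rw [← this]; abel
      zero_mem' := ⟨fun i => by simp, fun i j => by simp, fun i j k => by simp⟩
      smul_mem' := by
        rintro c a ⟨ha0, ha1, ha2⟩
        refine ⟨fun i => by simp [ha0], fun i j => ?_, fun i j k => ?_⟩
        · simp only [Pi.smul_apply]; rw [ha1 i j, smul_neg]
        · have := congrArg (c • ·) (ha2 i j k)
          simp only [smul_add, smul_sub, smul_zero] at this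
          simp only [Pi.smul_apply]
          rw [smul_comm (x i), smul_comm (x j), smul_comm (x k), this] }
  let d : (ι → M) →ₗ[R] (ι → ι → M) :=
    LinearMap.pi fun i => LinearMap.pi fun j =>
      x i • LinearMap.proj j - x j • LinearMap.proj i
  have hd : ∀ y i j, d y i j = x i • y j - x j • y i := fun y i j => rfl
  have hmem : z ∈ LinearMap.range d := by
    refine mem_of_mem_radical Z _ hf (fun z hz l => ?_) (fun z hz h => ?_) ⟨hz0, hz1, hz2⟩
    · obtain ⟨-, -, h2⟩ := hz
      refine ⟨fun j => z l j, funext fun i => funext fun j => ?_⟩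
      have := h2 l i j
      rw [hd, Pi.smul_apply, Pi.smul_apply, ← sub_eq_zero, ← neg_eq_zero, ← this]
      abel
    · obtain ⟨y, hy⟩ := h
      have hy' : ∀ i j, x i • y j - x j • y i = f • z i j :=
        fun i j => congrFun (congrFun hy i) j
      obtain ⟨w, hw⟩ := h1 (fun i => Submodule.Quotient.mk (y i)) fun i j => by
        rw [← sub_eq_zero, ← Submodule.Quotient.mk_smul, ← Submodule.Quotient.mk_smul,
          ← Submodule.Quotient.mk_sub, quotSMulTop_mk_eq_zero]
        exact ⟨z i j, (hy' i j).symm⟩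
      obtain ⟨w, rfl⟩ := Submodule.Quotient.mk_surjective _ w
      have hw' : ∀ i, ∃ u, f • u = y i - x i • w := fun i => by
        rw [← quotSMulTop_mk_eq_zero, Submodule.Quotient.mk_sub, Submodule.Quotient.mk_smul, hw i,
          sub_self]
      choose u hu using hw'
      refine ⟨u, funext fun i => funext fun j => hreg ?_⟩
      change f • d u i j = f • z i j
      rw [hd, smul_sub, smul_comm f, smul_comm f, hu, hu, ← hy', smul_sub, smul_sub,
        smul_comm (x i) (x j)]
      abel
  obtain ⟨y, rfl⟩ := hmem
  exact ⟨y, fun i j => rfl⟩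

lemma KoszulExactZero.quotSMulTop (hreg : IsSMulRegular M f) (h0 : KoszulExactZero x M)
    (h1 : KoszulExactOne x M) : KoszulExactZero x (QuotSMulTop f M) := by
  intro m hm
  obtain ⟨y, rfl⟩ := Submodule.Quotient.mk_surjective _ m
  have h : ∀ i, ∃ u, f • u = x i • y := fun i => by
    rw [← quotSMulTop_mk_eq_zero, Submodule.Quotient.mk_smul, hm i]
  choose u hu using h
  obtain ⟨m, hm⟩ := h1 u fun i j => hreg <| by
    change f • x i • u j = f • x j • u i
    rw [smul_comm, hu, smul_comm f, hu, smul_comm]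
  rw [quotSMulTop_mk_eq_zero]
  refine ⟨m, sub_eq_zero.1 (h0 _ fun i => ?_)⟩
  rw [smul_sub, smul_comm, ← hm, hu, sub_self]

lemma KoszulExactOne.quotSMulTop (hreg : IsSMulRegular M f) (h1 : KoszulExactOne x M)
    (h2 : KoszulExactTwo x M) : KoszulExactOne x (QuotSMulTop f M) := by
  intro y hy
  choose y' hy' using fun i => Submodule.Quotient.mk_surjective _ (y i)
  obtain rfl : (fun i => Submodule.Quotient.mk (y' i)) = y := funext hy'
  have h : ∀ i j, ∃ u, f • u = x i • y' j - x j • y' i := fun i j => by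
    rw [← quotSMulTop_mk_eq_zero, Submodule.Quotient.mk_sub, sub_eq_zero]
    exact hy i j
  choose z hz using h
  obtain ⟨w, hw⟩ := h2 z
    (fun i => hreg.right_eq_zero_of_smul (by rw [hz, sub_self]))
    (fun i j => hreg (by simp only [smul_neg, hz, neg_sub]))
    (fun i j k => hreg.right_eq_zero_of_smul <| by
      rw [smul_add, smul_sub, smul_comm f, smul_comm f, smul_comm f, hz, hz, hz, smul_sub, smul_sub,
        smul_sub, smul_comm (x i) (x j), smul_comm (x i) (x k), smul_comm (x j) (x k)]
      abel)
  obtain ⟨m, hm⟩ := h1 (fun i => y' i - f • w i) fun i j => by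
    have := hz i j
    rw [hw, smul_sub, smul_comm f, smul_comm f] at this
    rw [smul_sub, smul_sub, ← sub_eq_zero, sub_sub_sub_comm, this, sub_self]
  refine ⟨Submodule.Quotient.mk m, fun i => ?_⟩
  rw [← sub_eq_zero, ← Submodule.Quotient.mk_smul, ← Submodule.Quotient.mk_sub,
    quotSMulTop_mk_eq_zero]
  exact ⟨w i, by rw [← hm]; abel⟩

/-- Prime avoidance: the ideal `I` contains an element outside all the associated primes of `M`,
as it is not contained in any of them. -/
lemma KoszulExactZero.exists_isSMulRegular [IsNoetherianRing R] [Module.Finite R M] {I : Ideal R}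
    (hx : ∀ i, x i ∈ I) (h0 : KoszulExactZero x M) : ∃ f ∈ I, IsSMulRegular M f := by
  by_contra! hcon
  have hsub : (I : Set R) ⊆ ⋃ p ∈ ((associatedPrimes.finite R M).toFinset : Set (Ideal R)),
      (p : Set R) := by
    intro f hf
    rw [Set.Finite.coe_toFinset, biUnion_associatedPrimes_eq_compl_regular]
    exact hcon f hf
  obtain ⟨p, hp, hIp⟩ := (Ideal.subset_union_prime (f := id) ⊤ ⊤ (fun p hp _ _ =>
    ((associatedPrimes.finite R M).mem_toFinset.1 hp).isPrime)).1 hsub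
  have hp' : IsAssociatedPrime p M := (associatedPrimes.finite R M).mem_toFinset.1 hp
  obtain ⟨hprime, m, hm⟩ := isAssociatedPrime_iff.1 hp'
  have hm0 : m = 0 := h0 m fun i => by
    have : x i ∈ p := hIp (hx i)
    rw [hm, Submodule.mem_colon_singleton] at this
    exact (Submodule.mem_bot R).1 this
  refine hprime.ne_top ((Ideal.eq_top_iff_one _).2 ?_)
  rw [hm, Submodule.mem_colon_singleton, hm0, smul_zero]
  exact Submodule.zero_mem _

variable {I : Ideal R}

lemma isRegular_of_isWeaklyRegular_of_mem (hI : I ≠ ⊤) {rs : List R} (hmem : ∀ r ∈ rs, r ∈ I)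
    (h : RingTheory.Sequence.IsWeaklyRegular R rs) : RingTheory.Sequence.IsRegular R rs := by
  refine ⟨h, fun htop => hI (top_unique ?_)⟩
  rw [smul_eq_mul, Ideal.mul_top] at htop
  rw [htop]
  exact Ideal.span_le.2 hmem

lemma exists_isRegular_two_le_iff [IsNoetherianRing R] (hI : I ≠ ⊤)
    (hrad : I ≤ (Ideal.span (Set.range x)).radical) (hx : ∀ i, x i ∈ I) (hf : f ∈ I)
    (hreg : IsSMulRegular R f) :
    (∃ rs : List R, (∀ r ∈ rs, r ∈ I) ∧ RingTheory.Sequence.IsRegular R rs ∧ 2 ≤ rs.length) ↔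
      KoszulExactOne x R := by
  constructor
  · rintro ⟨_ | ⟨g, _ | ⟨h, t⟩⟩, hmem, hrs, hlen⟩
    · simp at hlen
    · simp at hlen
    · have hw := hrs.toIsWeaklyRegular
      simp only [RingTheory.Sequence.isWeaklyRegular_cons_iff] at hw
      exact koszulExactOne_of_quotSMulTop (hrad (hmem g (by simp))) hw.1
        (koszulExactZero_of_isSMulRegular (hrad (hmem h (by simp))) hw.2.1)
  · intro h1
    have h0 := koszulExactZero_of_isSMulRegular (hrad hf) hreg
    obtain ⟨g, hg, hgreg⟩ := (h0.quotSMulTop hreg h1).exists_isSMulRegular hx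
    have hmem : ∀ r ∈ [f, g], r ∈ I := by simp [hf, hg]
    refine ⟨[f, g], hmem, isRegular_of_isWeaklyRegular_of_mem hI hmem ?_, le_rfl⟩
    simp [hreg, hgreg, RingTheory.Sequence.IsWeaklyRegular.nil]

lemma exists_isRegular_three_le_iff [IsNoetherianRing R] (hI : I ≠ ⊤)
    (hrad : I ≤ (Ideal.span (Set.range x)).radical) (hx : ∀ i, x i ∈ I) (hf : f ∈ I)
    (hreg : IsSMulRegular R f) :
    (∃ rs : List R, (∀ r ∈ rs, r ∈ I) ∧ RingTheory.Sequence.IsRegular R rs ∧ 3 ≤ rs.length) ↔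
      KoszulExactOne x R ∧ KoszulExactTwo x R := by
  constructor
  · rintro ⟨_ | ⟨g, _ | ⟨h, _ | ⟨k, t⟩⟩⟩, hmem, hrs, hlen⟩
    · simp at hlen
    · simp at hlen
    · simp at hlen
    · have hw := hrs.toIsWeaklyRegular
      simp only [RingTheory.Sequence.isWeaklyRegular_cons_iff] at hw
      obtain ⟨hg, hh, hk, -⟩ := hw
      have hgI := hrad (hmem g (by simp))
      have hhI := hrad (hmem h (by simp))
      have hkI := hrad (hmem k (by simp))
      exact ⟨koszulExactOne_of_quotSMulTop hgI hg (koszulExactZero_of_isSMulRegular hhI hh),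
        koszulExactTwo_of_quotSMulTop hgI hg (koszulExactOne_of_quotSMulTop hhI hh
          (koszulExactZero_of_isSMulRegular hkI hk))⟩
  · rintro ⟨h1, h2⟩
    have h0 := koszulExactZero_of_isSMulRegular (hrad hf) hreg
    have h0' := h0.quotSMulTop hreg h1
    have h1' := h1.quotSMulTop hreg h2
    obtain ⟨g, hg, hgreg⟩ := h0'.exists_isSMulRegular hx
    obtain ⟨h, hh, hhreg⟩ := (h0'.quotSMulTop hgreg h1').exists_isSMulRegular hx
    have hmem : ∀ r ∈ [f, g, h], r ∈ I := by simp [hf, hg, hh]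
    refine ⟨[f, g, h], hmem, isRegular_of_isWeaklyRegular_of_mem hI hmem ?_, le_rfl⟩
    simp [hreg, hgreg, hhreg, RingTheory.Sequence.IsWeaklyRegular.nil]

end Koszul

/-! ### Coefficients of semigroup ring elements -/

section Coefficients

variable {𝕜 : Type*} [Field 𝕜] {d : ℕ} {S : AddSubmonoid (Fin d → ℤ)}

open Classical in
/-- The coefficient of `t ^ v` in an element of `𝕜[S]`, for an arbitrary `v ∈ ℤ^d`: it is zero when
`v ∉ S`. -/
noncomputable def coeffAt (f : AddMonoidAlgebra 𝕜 S) (v : Fin d → ℤ) : 𝕜 :=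
  if h : v ∈ S then f.coeff ⟨v, h⟩ else 0

lemma coeffAt_of_notMem (f : AddMonoidAlgebra 𝕜 S) {v : Fin d → ℤ} (h : v ∉ S) :
    coeffAt f v = 0 := dif_neg h

lemma mem_of_coeffAt_ne_zero {f : AddMonoidAlgebra 𝕜 S} {v : Fin d → ℤ} (h : coeffAt f v ≠ 0) :
    v ∈ S := by
  by_contra hv
  exact h (coeffAt_of_notMem f hv)

lemma coeffAt_coe (f : AddMonoidAlgebra 𝕜 S) (s : S) : coeffAt f s = f.coeff s :=
  dif_pos s.2

lemma coeffAt_injective :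
    Function.Injective (coeffAt : AddMonoidAlgebra 𝕜 S → (Fin d → ℤ) → 𝕜) := by
  intro f g h
  ext s
  rw [← coeffAt_coe, ← coeffAt_coe, h]

@[simp] lemma coeffAt_zero (v : Fin d → ℤ) : coeffAt (0 : AddMonoidAlgebra 𝕜 S) v = 0 := by
  simp [coeffAt]

@[simp] lemma coeffAt_add (f g : AddMonoidAlgebra 𝕜 S) (v : Fin d → ℤ) :
    coeffAt (f + g) v = coeffAt f v + coeffAt g v := by
  unfold coeffAt; split_ifs <;> simp

@[simp] lemma coeffAt_neg (f : AddMonoidAlgebra 𝕜 S) (v : Fin d → ℤ) :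
    coeffAt (-f) v = -coeffAt f v := by
  unfold coeffAt; split_ifs <;> simp

@[simp] lemma coeffAt_sub (f g : AddMonoidAlgebra 𝕜 S) (v : Fin d → ℤ) :
    coeffAt (f - g) v = coeffAt f v - coeffAt g v := by
  rw [sub_eq_add_neg, coeffAt_add, coeffAt_neg, sub_eq_add_neg]

lemma coeffAt_single (s : S) (v : Fin d → ℤ) [Decidable (v = s)] :
    coeffAt (AddMonoidAlgebra.single s (1 : 𝕜)) v = if v = s then 1 else 0 := by
  classical
  by_cases hv : v ∈ S
  · lift v to S using hv
    rw [coeffAt_coe, AddMonoidAlgebra.coeff_single, Finsupp.single_apply]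
    simp [eq_comm]
  · rw [coeffAt_of_notMem _ hv, if_neg]
    rintro rfl
    exact hv s.2

@[simp] lemma coeffAt_single_mul (s : S) (f : AddMonoidAlgebra 𝕜 S) (v : Fin d → ℤ) :
    coeffAt (AddMonoidAlgebra.single s 1 * f) v = coeffAt f (v - s) := by
  by_cases h : v - s ∈ S
  · obtain ⟨u, hu⟩ : ∃ u : S, (u : Fin d → ℤ) = v - s := ⟨⟨_, h⟩, rfl⟩
    have hv : v = ((s + u : S) : Fin d → ℤ) := by simp [hu]
    rw [← hu, hv, coeffAt_coe, coeffAt_coe, AddMonoidAlgebra.coeff_single_mul_add, one_mul]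
  · rw [coeffAt_of_notMem f h]
    by_cases hv : v ∈ S
    · lift v to S using hv
      rw [coeffAt_coe, AddMonoidAlgebra.coeff_single_mul_of_forall_add_ne]
      rintro u rfl
      exact h (by simp)
    · exact coeffAt_of_notMem _ hv

lemma finite_coeffAt_ne_zero (f : AddMonoidAlgebra 𝕜 S) : {v | coeffAt f v ≠ 0}.Finite := by
  refine (f.coeff.support.finite_toSet.image (Subtype.val : S → Fin d → ℤ)).subset fun v hv => ?_
  refine ⟨⟨v, mem_of_coeffAt_ne_zero hv⟩, ?_, rfl⟩
  rw [Finset.mem_coe, Finsupp.mem_support_iff, ← coeffAt_coe]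
  exact hv

lemma exists_coeffAt_eq (g : (Fin d → ℤ) → 𝕜) (hfin : {v | g v ≠ 0}.Finite)
    (hS : ∀ v, g v ≠ 0 → v ∈ S) : ∃ f : AddMonoidAlgebra 𝕜 S, ∀ v, coeffAt f v = g v := by
  refine ⟨.ofCoeff (Finsupp.ofSupportFinite (fun s : S => g s)
    (hfin.preimage Subtype.val_injective.injOn)), fun v => ?_⟩
  by_cases hv : v ∈ S
  · lift v to S using hv
    rw [coeffAt_coe]
    rfl
  · rw [coeffAt_of_notMem _ hv]
    by_contra h
    exact hv (hS v (Ne.symm h))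

lemma isSMulRegular_single (s : S) :
    IsSMulRegular (AddMonoidAlgebra 𝕜 S) (AddMonoidAlgebra.single s (1 : 𝕜)) := by
  refine .of_right_eq_zero_of_smul fun f hf => coeffAt_injective (funext fun v => ?_)
  have := congrArg (fun g : AddMonoidAlgebra 𝕜 S => coeffAt g (v + s)) hf
  simpa using this

lemma exists_single_mul_eq_iff (c : S) (f : AddMonoidAlgebra 𝕜 S) :
    (∃ u, AddMonoidAlgebra.single c 1 * u = f) ↔
      ∀ v, coeffAt f v ≠ 0 → v - (c : Fin d → ℤ) ∈ S := by
  constructor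
  · rintro ⟨u, rfl⟩ v hv
    rw [coeffAt_single_mul] at hv
    exact mem_of_coeffAt_ne_zero hv
  · intro h
    obtain ⟨u, hu⟩ := exists_coeffAt_eq (S := S) (fun v => coeffAt f (v + (c : Fin d → ℤ)))
      ((finite_coeffAt_ne_zero f).preimage (add_left_injective _).injOn)
      (fun v hv => by simpa using h _ hv)
    exact ⟨u, coeffAt_injective (funext fun v => by simp [hu])⟩

end Coefficients

/-! ### Maximal elements -/

/-- The order `x ⪯ y ↔ y - x ∈ S` is antisymmetric as soon as `S` has no nonzero unit; a set whose
part above one of its members is finite then has a maximal element. -/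
lemma hasMaximal_of_finite {d : ℕ} {S : AddSubmonoid (Fin d → ℤ)}
    (hpt : ∀ s ∈ S, -s ∈ S → s = 0) {X : Set (Fin d → ℤ)} {b : Fin d → ℤ}
    (hb : b ∈ X) (hfin : {s | s ∈ S ∧ b + s ∈ X}.Finite) : HasMaximal S X := by
  let T := {s | s ∈ S ∧ b + s ∈ X}
  let r : T → T → Prop := fun s t => (s : Fin d → ℤ) - t ∈ S ∧ s ≠ t
  have : Finite T := hfin
  have : IsTrans T r := by
    refine ⟨fun s t u hst htu => ⟨?_, ?_⟩⟩
    · have := S.add_mem hst.1 htu.1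
      rwa [sub_add_sub_cancel] at this
    · rintro rfl
      have := hpt _ hst.1 (by rw [neg_sub]; exact htu.1)
      exact hst.2 (Subtype.ext (sub_eq_zero.1 this))
  have : Std.Irrefl r := ⟨fun s h => h.2 rfl⟩
  obtain ⟨⟨m, hmS, hmX⟩, -, hm⟩ := (Finite.wellFounded_of_trans_of_irrefl r).has_min Set.univ
    ⟨⟨0, S.zero_mem, by rwa [add_zero]⟩, trivial⟩
  refine ⟨b + m, hmX, fun x hx hxm => ?_⟩
  have hxb : b + (x - b) = x := by abel
  have hxS : x - b ∈ S := by
    have := S.add_mem hxm hmS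
    rwa [show x - (b + m) + m = x - b by abel] at this
  by_contra hne
  refine hm ⟨x - b, hxS, hxb.symm ▸ hx⟩ trivial ⟨?_, fun h => hne ?_⟩
  · rwa [sub_sub]
  · rw [← show x - b = m from congrArg Subtype.val h, hxb]

/-! ### Koszul cohomology of a semigroup ring -/

section SemigroupRing

variable {𝕜 : Type*} [Field 𝕜] {d : ℕ} {S : AddSubmonoid (Fin d → ℤ)} {ι : Type*}

/-- The first Koszul cohomology, in terms of maximal elements: a nonzero class of
`𝕜[S] / (t ^ c)` killed by all the `t ^ (E i)` contains a monomial `t ^ v` with the same property,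
and only finitely many elements of `Ap S c` lie above such a `v`. -/
lemma koszulExactZero_quotSMulTop_single_iff [Nonempty ι] (hpt : ∀ s ∈ S, -s ∈ S → s = 0)
    (E : ι → S) (hE0 : ∀ i, E i ≠ 0)
    (hfin : {s | s ∈ S ∧ ∀ i, s - (E i : Fin d → ℤ) ∉ S}.Finite) (c : S) :
    KoszulExactZero (fun i => AddMonoidAlgebra.single (E i) (1 : 𝕜))
        (QuotSMulTop (AddMonoidAlgebra.single c (1 : 𝕜)) (AddMonoidAlgebra 𝕜 S)) ↔
      ¬ HasMaximal S (Ap S (c : Fin d → ℤ)) := by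
  classical
  constructor
  · rintro h ⟨m, ⟨hmS, hmc⟩, hmax⟩
    lift m to S using hmS
    have h0 := h (Submodule.Quotient.mk (AddMonoidAlgebra.single m 1)) fun i => by
      rw [← Submodule.Quotient.mk_smul, quotSMulTop_mk_eq_zero]
      refine (exists_single_mul_eq_iff c _).2 fun v hv => ?_
      rw [smul_eq_mul, coeffAt_single_mul, coeffAt_single] at hv
      have hv' : v = m + E i := by
        rw [← sub_eq_iff_eq_add]
        by_contra hne
        exact hv (if_neg hne)
      by_contra hc
      refine hE0 i (Subtype.ext ?_)
      have := hmax v ⟨hv' ▸ S.add_mem m.2 (E i).2, hc⟩ (by rw [hv']; simp)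
      simpa [hv'] using this
    refine hmc ((exists_single_mul_eq_iff (𝕜 := 𝕜) c _).1 (quotSMulTop_mk_eq_zero.1 h0) m ?_)
    simp [coeffAt_single]
  · intro hmax m hm
    obtain ⟨f, rfl⟩ := Submodule.Quotient.mk_surjective _ m
    rw [quotSMulTop_mk_eq_zero]
    refine (exists_single_mul_eq_iff c f).2 fun v hv => ?_
    by_contra hvc
    have hstep : ∀ i, v + E i - c ∈ S := fun i => by
      have hi := hm i
      rw [← Submodule.Quotient.mk_smul, quotSMulTop_mk_eq_zero] at hi
      refine (exists_single_mul_eq_iff c _).1 hi _ ?_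
      simpa using hv
    refine hmax (hasMaximal_of_finite hpt (b := v) ⟨mem_of_coeffAt_ne_zero hv, hvc⟩
      (hfin.subset ?_))
    rintro s ⟨hs, -, hsc⟩
    refine ⟨hs, fun i hi => hsc ?_⟩
    have := S.add_mem (hstep i) hi
    convert this using 1
    abel

/-- A nonzero class in the second Koszul cohomology of `𝕜[S]`, in degree `p`. A cocycle of that
degree has components `(η j - η i) t ^ (p + E i + E j)`, for a family of scalars `η` for which the
exponent lies in `S` whenever the coefficient is nonzero; it is a coboundary if and only if `η` is
constant on the indices `i` with `p + E i ∉ S`. -/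
def HasDegreeTwoClass (𝕜 : Type*) (S : AddSubmonoid (Fin d → ℤ)) (E : ι → S) : Prop :=
  ∃ (p : Fin d → ℤ) (η : ι → 𝕜), (∀ u v, p + E u + E v ∉ S → η u = η v) ∧
    ∃ i j, p + E i ∉ S ∧ p + E j ∉ S ∧ η i ≠ η j

lemma HasDegreeTwoClass.not_koszulExactTwo {E : ι → S} (h : HasDegreeTwoClass 𝕜 S E) :
    ¬ KoszulExactTwo (fun i => AddMonoidAlgebra.single (E i) (1 : 𝕜)) (AddMonoidAlgebra 𝕜 S) := by
  classical
  obtain ⟨p, η, hη, i, j, hi, hj, hij⟩ := h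
  intro hex
  have hz : ∀ u v : ι, ∃ f : AddMonoidAlgebra 𝕜 S, ∀ w,
      coeffAt f w = if w = p + E u + E v then η v - η u else 0 := fun u v => by
    refine exists_coeffAt_eq _ ((Set.finite_singleton (p + E u + E v : Fin d → ℤ)).subset ?_) ?_
    · intro w hw
      by_contra hne
      exact hw (if_neg hne)
    · intro w hw
      by_contra hwS
      refine hw ?_
      split_ifs with hwe
      · rw [hη u v (hwe ▸ hwS), sub_self]
      · rfl
  choose z hz using hz
  obtain ⟨y, hy⟩ := hex z
    (fun u => coeffAt_injective (funext fun w => by simp [hz]))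
    (fun u v => coeffAt_injective (funext fun w => by
      rw [coeffAt_neg, hz, hz, add_right_comm]
      split_ifs <;> simp))
    (fun u v w => coeffAt_injective (funext fun q => by
      simp only [smul_eq_mul, coeffAt_add, coeffAt_sub, coeffAt_single_mul, hz, coeffAt_zero,
        sub_eq_iff_eq_add]
      rw [show (p + E v + E w + E u : Fin d → ℤ) = p + E u + E v + E w by abel,
        show (p + E u + E w + E v : Fin d → ℤ) = p + E u + E v + E w by abel]
      split_ifs <;> ring))
  have := congrArg (fun g : AddMonoidAlgebra 𝕜 S => coeffAt g (p + E i + E j)) (hy i j)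
  simp only [smul_eq_mul, coeffAt_sub, coeffAt_single_mul, hz, if_true, add_sub_cancel_right,
    coeffAt_of_notMem _ hi, sub_zero] at this
  rw [show (p + E i + E j - E i : Fin d → ℤ) = p + E j by abel, coeffAt_of_notMem _ hj] at this
  exact hij (sub_eq_zero.1 this).symm

lemma koszulExactTwo_of_not_hasDegreeTwoClass [Finite ι] [Nonempty ι] {E : ι → S}
    (h : ¬ HasDegreeTwoClass 𝕜 S E) :
    KoszulExactTwo (fun i => AddMonoidAlgebra.single (E i) (1 : 𝕜)) (AddMonoidAlgebra 𝕜 S) := by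
  classical
  obtain ⟨o⟩ := ‹Nonempty ι›
  intro z hz0 hz1 hz2
  set ζ : (Fin d → ℤ) → ι → ι → 𝕜 := fun p u v => coeffAt (z u v) (p + E u + E v) with hζ
  have hζsub : ∀ p u v, ζ p u v = ζ p o v - ζ p o u := fun p u v => by
    have := congrArg (fun g : AddMonoidAlgebra 𝕜 S => coeffAt g (p + E o + E u + E v))
      (hz2 o u v)
    simp only [smul_eq_mul, coeffAt_add, coeffAt_sub, coeffAt_single_mul, coeffAt_zero] at this
    rw [show (p + E o + E u + E v - E o : Fin d → ℤ) = p + E u + E v by abel,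
      show (p + E o + E u + E v - E u : Fin d → ℤ) = p + E o + E v by abel,
      show (p + E o + E u + E v - E v : Fin d → ℤ) = p + E o + E u by abel] at this
    simp only [hζ]
    linear_combination this
  -- In each degree, a primitive supported in `S`; the last clause makes the supports finite.
  have hθ : ∀ p, ∃ θ : ι → 𝕜, (∀ u v, ζ p u v = θ v - θ u) ∧
      (∀ i, p + E i ∉ S → θ i = 0) ∧ ((∀ u v, ζ p u v = 0) → ∀ i, θ i = 0) := fun p => by
    by_cases hzero : ∀ u v, ζ p u v = 0
    · exact ⟨0, by simp [hzero], by simp, by simp⟩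
    have hconst : ∀ i j, p + E i ∉ S → p + E j ∉ S → ζ p o i = ζ p o j := by
      intro i j hi hj
      by_contra hne
      refine h ⟨p, ζ p o, fun u v huv => ?_, i, j, hi, hj, hne⟩
      have h0 : ζ p u v = 0 := coeffAt_of_notMem _ huv
      rw [hζsub] at h0
      exact (sub_eq_zero.1 h0).symm
    by_cases hex : ∃ i, p + E i ∉ S
    · obtain ⟨i, hi⟩ := hex
      refine ⟨fun j => ζ p o j - ζ p o i, fun u v => ?_, fun j hj => ?_,
        fun h => absurd h hzero⟩
      · rw [hζsub]; ring
      · exact sub_eq_zero.2 (hconst j i hj hi)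
    · exact ⟨ζ p o, hζsub p, fun i hi => absurd ⟨i, hi⟩ hex, fun h => absurd h hzero⟩
  choose θ hθ1 hθ2 hθ3 using hθ
  have hy : ∀ i, ∃ f : AddMonoidAlgebra 𝕜 S, ∀ w, coeffAt f w = θ (w - E i) i := fun i => by
    refine exists_coeffAt_eq _ ?_ ?_
    · refine (Set.finite_iUnion fun u => Set.finite_iUnion fun v =>
        (finite_coeffAt_ne_zero (z u v)).preimage
          (f := fun w : Fin d → ℤ => w - E i + E u + E v) ?_).subset ?_
      · intro a _ b _ hab
        simpa using hab
      · intro w hw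
        by_contra hcon
        simp only [Set.mem_iUnion, Set.mem_preimage, Set.mem_ofPred_eq, not_exists, not_not] at hcon
        exact hw (hθ3 _ hcon i)
    · intro w hw
      by_contra hwS
      exact hw (hθ2 _ i (by simpa using hwS))
  choose y hy using hy
  refine ⟨y, fun i j => coeffAt_injective (funext fun w => ?_)⟩
  simp only [smul_eq_mul, coeffAt_sub, coeffAt_single_mul, hy]
  have := hθ1 (w - E i - E j) i j
  simp only [hζ, sub_add_cancel, sub_right_comm w (E i : Fin d → ℤ) (E j)] at this
  rw [this, sub_right_comm]

/-- A class of degree two amounts to a set of indices `{u | η u = η j}`, containing `j` but not `i`,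
such that `p + E u + E v ∈ S` whenever `u` is outside the set and `v` inside; here `i` and `j` are
two indices with `p + E i ∉ S` and `p + E j ∉ S`. Put `b = p + E i + E j`. Up to the exchange of `i`
and `j`, this is `CondOne` if the other two indices lie on the same side, `CondTwo` if not. -/
lemma hasDegreeTwoClass_iff (E : Fin 4 → S) :
    HasDegreeTwoClass 𝕜 S E ↔
      ∃ i j k l : Fin 4, ({i, j, k, l} : Finset (Fin 4)) = Finset.univ ∧ ∃ b ∈ S,
        CondOne S (fun i => (E i : Fin d → ℤ)) i j k l b ∨
          CondTwo S (fun i => (E i : Fin d → ℤ)) i j k l b := by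
  classical
  constructor
  · rintro ⟨p, η, hη, i, j, hi, hj, hij⟩
    have hT : ∀ u v, η u ≠ η v → p + E u + E v ∈ S := fun u v h => by
      by_contra h'
      exact h (hη u v h')
    have hne : i ≠ j := fun h => hij (h ▸ rfl)
    obtain ⟨k, l, hkl⟩ : ∃ k l : Fin 4, ({i, j, k, l} : Finset (Fin 4)) = Finset.univ := by
      clear hi hj hij
      revert i j; decide
    have hb := hT i j hij
    have hbi : p + E i + E j - E i ∉ S := by
      rwa [show (p + E i + E j - E i : Fin d → ℤ) = p + E j by abel]
    have hbj : p + E i + E j - E j ∉ S := by rwa [add_sub_cancel_right]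
    have eqi : ∀ u : Fin 4, (p + E i + E j + E u - E i : Fin d → ℤ) = p + E j + E u :=
      fun u => by abel
    have eqj : ∀ u : Fin 4, (p + E i + E j + E u - E j : Fin d → ℤ) = p + E i + E u :=
      fun u => by abel
    have eqij : (p + E i + E j + E k + E l - (E i + E j) : Fin d → ℤ) = p + E k + E l := by abel
    by_cases hk : η k = η j <;> by_cases hl : η l = η j
    · refine ⟨j, i, k, l, by rw [← hkl, Finset.insert_comm], _, hb, Or.inl
        ⟨⟨⟨hb, hbj⟩, hb, hbi⟩, ?_, ?_⟩⟩
      · rw [eqj]; exact hT _ _ (hk ▸ hij)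
      · rw [eqj]; exact hT _ _ (hl ▸ hij)
    · refine ⟨j, i, k, l, by rw [← hkl, Finset.insert_comm], _, hb, ?_⟩
      refine Or.inr ⟨⟨⟨hb, hbj⟩, hb, hbi⟩, ?_, ?_, ?_⟩
      · rw [eqj]; exact hT _ _ (hk ▸ hij)
      · rw [eqi]; exact hT _ _ (Ne.symm hl)
      · rw [add_comm (E j : Fin d → ℤ), eqij]; exact hT _ _ (hk ▸ Ne.symm hl)
    · refine ⟨i, j, k, l, hkl, _, hb, Or.inr ⟨⟨⟨hb, hbi⟩, hb, hbj⟩, ?_, ?_, ?_⟩⟩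
      · rw [eqi]; exact hT _ _ (Ne.symm hk)
      · rw [eqj]; exact hT _ _ (hl ▸ hij)
      · rw [eqij]; exact hT _ _ (hl ▸ hk)
    · refine ⟨i, j, k, l, hkl, _, hb, Or.inl ⟨⟨⟨hb, hbi⟩, hb, hbj⟩, ?_, ?_⟩⟩
      · rw [eqi]; exact hT _ _ (Ne.symm hk)
      · rw [eqi]; exact hT _ _ (Ne.symm hl)
  · rintro ⟨i, j, k, l, hijkl, b, -, h⟩
    have hcases : ∀ u : Fin 4, u = i ∨ u = j ∨ u = k ∨ u = l := fun u => by
      have := Finset.mem_univ u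
      rw [← hijkl] at this
      simpa using this
    have hdist : i ≠ j ∧ i ≠ l := by
      clear hcases h
      revert i j k l; decide
    obtain ⟨hb, ⟨-, hbi⟩, -, hbj⟩ : b ∈ S ∧ b ∈ Ap S (E i : Fin d → ℤ) ∧
        b ∈ Ap S (E j : Fin d → ℤ) := by
      rcases h with ⟨h, -⟩ | ⟨h, -⟩ <;> exact ⟨h.1.1, h⟩
    have hpi : b - E i - E j + E i ∉ S := by
      rwa [show (b - E i - E j + E i : Fin d → ℤ) = b - E j by abel]
    have hpj : b - E i - E j + E j ∉ S := by rwa [sub_add_cancel]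
    have hcomm : ∀ u v, (b - E i - E j + E u + E v : Fin d → ℤ) = b - E i - E j + E v + E u :=
      fun u v => by abel
    have hij : (b - E i - E j + E i + E j : Fin d → ℤ) = b := by abel
    have hju : ∀ u, (b - E i - E j + E u + E j : Fin d → ℤ) = b + E u - E i := fun u => by abel
    -- It is enough to find a set of indices, containing `j` but not `i`, all of whose members are
    -- joined to all its non-members.
    suffices ∃ s : Set (Fin 4), i ∉ s ∧ j ∈ s ∧ ∀ u ∉ s, ∀ v ∈ s,
        b - E i - E j + E u + E v ∈ S by
      obtain ⟨s, his, hjs, hs⟩ := this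
      refine ⟨b - E i - E j, s.indicator 1, fun u v huv => ?_, i, j, hpi, hpj, by simp [his, hjs]⟩
      by_cases hu : u ∈ s <;> by_cases hv : v ∈ s
      · simp [hu, hv]
      · exact absurd (hcomm u v ▸ hs v hv u hu) huv
      · exact absurd (hs u hu v hv) huv
      · simp [hu, hv]
    rcases h with ⟨-, h1, h2⟩ | ⟨-, h1, h2, h3⟩
    · refine ⟨{j}, hdist.1, rfl, ?_⟩
      rintro u hu _ rfl
      rcases hcases u with rfl | rfl | rfl | rfl
      · rwa [hij]
      · exact absurd rfl hu
      · rwa [hju]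
      · rwa [hju]
    · refine ⟨{j, l}, by simp [hdist.1, hdist.2], by simp, ?_⟩
      rintro u hu v (rfl | rfl)
      · rcases hcases u with rfl | rfl | rfl | rfl
        · rwa [hij]
        · simp at hu
        · rwa [hju]
        · simp at hu
      · rcases hcases u with rfl | rfl | rfl | rfl
        · rwa [show (b - E u - E j + E u + E v : Fin d → ℤ) = b + E v - E j by abel]
        · simp at hu
        · rwa [show (b - E i - E j + E u + E v : Fin d → ℤ) = b + E u + E v - (E i + E j) by abel]
        · simp at hu

end SemigroupRing

/-! ### Simplicial affine semigroups -/

section Simplicial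

variable {d e : ℕ}

lemma nonneg_of_mem_semigroup (a : Fin e → Fin d → ℕ) {s : Fin d → ℤ} (hs : s ∈ semigroup a) :
    0 ≤ s := by
  induction hs using AddSubmonoid.closure_induction with
  | mem s hs => obtain ⟨j, rfl⟩ := hs; exact fun c => Int.natCast_nonneg _
  | zero => exact le_rfl
  | add s t _ _ hs ht => exact add_nonneg hs ht

lemma eq_zero_of_neg_mem_semigroup (a : Fin e → Fin d → ℕ) {s : Fin d → ℤ} (hs : s ∈ semigroup a)
    (hs' : -s ∈ semigroup a) : s = 0 :=
  le_antisymm (neg_nonneg.1 (nonneg_of_mem_semigroup a hs')) (nonneg_of_mem_semigroup a hs)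

lemma toInt_mem_semigroup (a : Fin e → Fin d → ℕ) (j : Fin e) : toInt (a j) ∈ semigroup a :=
  AddSubmonoid.subset_closure ⟨j, rfl⟩

lemma toInt_injective : Function.Injective (toInt : (Fin d → ℕ) → Fin d → ℤ) := fun _ _ h =>
  funext fun c => Int.ofNat_injective (congrFun h c)

lemma IsSimplicialGenerators.toInt_ne_zero {hde : d ≤ e} {a : Fin e → Fin d → ℕ}
    (ha : IsSimplicialGenerators hde a) (j : Fin e) : toInt (a j) ≠ 0 := fun h =>
  ha.minimal j <| by
    rw [show a j = 0 from toInt_injective h]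
    exact AddSubmonoid.zero_mem _

lemma exists_natCast_eq_mul {ι : Type*} [Fintype ι] (q : ι → ℚ) (hq : ∀ i, 0 ≤ q i) :
    ∃ n : ℕ, 0 < n ∧ ∃ m : ι → ℕ, ∀ i, (n : ℚ) * q i = m i := by
  refine ⟨∏ i, (q i).den, Finset.prod_pos fun i _ => (q i).den_pos, ?_⟩
  have h : ∀ i, ∃ m : ℕ, ((∏ i, (q i).den : ℕ) : ℚ) * q i = m := fun i => by
    obtain ⟨r, hr⟩ := Finset.dvd_prod_of_mem (fun i => (q i).den) (Finset.mem_univ i)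
    refine ⟨r * (q i).num.toNat, ?_⟩
    have hnum : (((q i).num.toNat : ℕ) : ℚ) = (q i).num := by
      exact_mod_cast congrArg (Int.cast : ℤ → ℚ) (Int.toNat_of_nonneg (Rat.num_nonneg.2 (hq i)))
    rw [hr]
    push_cast
    rw [hnum, mul_comm ((q i).den : ℚ), mul_assoc, Rat.den_mul_eq_num]
  choose m hm using h
  exact ⟨m, hm⟩

/-- Some multiple of each generator is a combination of the extremal ones, hence lies above one of
them in the order of the semigroup. -/
lemma IsSimplicialGenerators.exists_smul_sub_mem {hde : d ≤ e} {a : Fin e → Fin d → ℕ}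
    (ha : IsSimplicialGenerators hde a) (j : Fin e) :
    ∃ n : ℕ, ∃ i : Fin d, n • toInt (a j) - toInt (extremal hde a i) ∈ semigroup a := by
  have hmem : toRat (a j) ∈ pos a := by
    refine ⟨Pi.single j 1, fun i => ?_, ?_⟩
    · by_cases h : i = j
      · subst h; simp
      · simp [h]
    · rw [Finset.sum_eq_single j (fun i _ h => by simp [h]) (by simp)]
      simp
  rw [ha.pos_eq] at hmem
  obtain ⟨q, hq, hsum⟩ := hmem
  obtain ⟨n, hn, m, hm⟩ := exists_natCast_eq_mul q hq
  have heq : n • toInt (a j) = ∑ i, m i • toInt (extremal hde a i) := by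
    funext c
    have h := congrFun hsum c
    rw [Finset.sum_apply] at h ⊢
    have h' : (n : ℚ) * toRat (a j) c = ∑ i, (m i : ℚ) * toRat (extremal hde a i) c := by
      rw [h, Finset.mul_sum]
      refine Finset.sum_congr rfl fun i _ => ?_
      rw [← hm, Pi.smul_apply, smul_eq_mul, mul_assoc]
    simp only [Pi.smul_apply, toInt, toRat, nsmul_eq_mul] at h' ⊢
    exact_mod_cast h'
  obtain ⟨i, hi⟩ : ∃ i, m i ≠ 0 := by
    by_contra! hzero
    simp only [hzero, zero_smul, Finset.sum_const_zero] at heq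
    exact (smul_ne_zero hn.ne' (ha.toInt_ne_zero j)) heq
  refine ⟨n, i, ?_⟩
  obtain ⟨r, hr⟩ := Nat.exists_eq_succ_of_ne_zero hi
  rw [heq, ← Finset.add_sum_erase _ _ (Finset.mem_univ i), hr, succ_nsmul, add_sub_right_comm,
    add_sub_cancel_right]
  exact add_mem (nsmul_mem (toInt_mem_semigroup a _) _)
    (sum_mem fun k _ => nsmul_mem (toInt_mem_semigroup a _) _)

/-- The intersection of the Apéry sets of the extremal generators is finite. -/
lemma IsSimplicialGenerators.finite_iInter_ap {hde : d ≤ e} {a : Fin e → Fin d → ℕ}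
    (ha : IsSimplicialGenerators hde a) :
    {s | s ∈ semigroup a ∧ ∀ i, s - toInt (extremal hde a i) ∉ semigroup a}.Finite := by
  choose n i hni using ha.exists_smul_sub_mem
  refine ((Set.Finite.pi' fun j => Set.finite_Iio (n j)).image
    fun c : Fin e → ℕ => ∑ j, c j • toInt (a j)).subset ?_
  rintro s ⟨hs, hsub⟩
  obtain ⟨c, rfl⟩ := AddSubmonoid.mem_closure_range_iff_of_fintype.1 hs
  refine ⟨c, fun j => ?_, rfl⟩
  by_contra hj
  obtain ⟨r, hr⟩ := Nat.exists_eq_add_of_le (not_lt.1 hj)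
  refine hsub (i j) ?_
  rw [← Finset.add_sum_erase _ _ (Finset.mem_univ j), hr, add_nsmul, add_assoc,
    add_sub_right_comm]
  exact add_mem (hni j) (add_mem (nsmul_mem (toInt_mem_semigroup a _) _)
    (sum_mem fun k _ => nsmul_mem (toInt_mem_semigroup a _) _))

lemma isNoetherianRing_semigroup (𝕜 : Type*) [Field 𝕜] (a : Fin e → Fin d → ℕ) :
    IsNoetherianRing (AddMonoidAlgebra 𝕜 (semigroup a)) := by
  have : AddMonoid.FG (semigroup a) := (AddMonoid.fg_iff_addSubmonoid_fg _).2
    ((AddSubmonoid.fg_iff _).2 ⟨_, rfl, Set.finite_range _⟩)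
  exact Algebra.FiniteType.isNoetherianRing 𝕜 _

end Simplicial

/-! ### The monomial maximal ideal and the depth -/

section Depth

variable {𝕜 : Type*} [Field 𝕜] {d : ℕ} {S : AddSubmonoid (Fin d → ℤ)}

lemma single_mem_monomialIdeal {s : S} (hs : s ≠ 0) :
    AddMonoidAlgebra.single s (1 : 𝕜) ∈ monomialIdeal 𝕜 S :=
  Ideal.subset_span ⟨s, hs, rfl⟩

lemma monomialIdeal_ne_top (hpt : ∀ s ∈ S, -s ∈ S → s = 0) : monomialIdeal 𝕜 S ≠ ⊤ := by
  intro h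
  have hcoeff : ∀ f ∈ monomialIdeal 𝕜 S, ∀ g, coeffAt (f * g) 0 = 0 := by
    intro f hf
    induction hf using Submodule.span_induction with
    | mem f hf =>
      obtain ⟨s, hs, rfl⟩ := hf
      intro g
      rw [coeffAt_single_mul, zero_sub]
      exact coeffAt_of_notMem g fun hneg => hs (Subtype.ext (hpt s s.2 hneg))
    | zero => simp
    | add f g _ _ hf hg => intro u; rw [add_mul, coeffAt_add, hf, hg, add_zero]
    | smul r f _ hf => intro g; rw [smul_eq_mul, mul_comm r, mul_assoc]; exact hf _
  have h1 := hcoeff 1 (h ▸ Submodule.mem_top) 1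
  rw [one_mul, AddMonoidAlgebra.one_def, coeffAt_single] at h1
  simp at h1

/-- Only finitely many multiples of `s ≠ 0` avoid all the `E i + S`. -/
lemma monomialIdeal_le_radical {ι : Type*} (E : ι → S)
    (hfin : {s | s ∈ S ∧ ∀ i, s - (E i : Fin d → ℤ) ∉ S}.Finite) :
    monomialIdeal 𝕜 S ≤
      (Ideal.span (Set.range fun i => AddMonoidAlgebra.single (E i) (1 : 𝕜))).radical := by
  refine Ideal.span_le.2 ?_
  rintro _ ⟨s, hs, rfl⟩
  obtain ⟨c, hc⟩ : ∃ c, (s : Fin d → ℤ) c ≠ 0 := by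
    by_contra! h
    exact hs (Subtype.ext (funext h))
  have hinj : Function.Injective fun n : ℕ => n • (s : Fin d → ℤ) := fun m n h => by
    have h' := congrFun h c
    simpa [hc] using h'
  obtain ⟨n, hn⟩ : ∃ n : ℕ, ∃ i, n • (s : Fin d → ℤ) - E i ∈ S := by
    by_contra! hcon
    exact Set.infinite_range_of_injective hinj
      (hfin.subset (by rintro _ ⟨n, rfl⟩; exact ⟨nsmul_mem s.2 n, hcon n⟩))
  obtain ⟨i, hi⟩ := hn
  refine ⟨n, ?_⟩
  rw [AddMonoidAlgebra.single_pow, one_pow,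
    show n • s = E i + ⟨_, hi⟩ from Subtype.ext (by simp), ← one_mul (1 : 𝕜),
    ← AddMonoidAlgebra.single_mul_single]
  exact Ideal.mul_mem_right _ _ (Ideal.subset_span ⟨i, by simp⟩)

lemma depth_eq_two_iff :
    depth 𝕜 S = 2 ↔
      (∃ rs : List (AddMonoidAlgebra 𝕜 S), (∀ r ∈ rs, r ∈ monomialIdeal 𝕜 S) ∧
        RingTheory.Sequence.IsRegular (AddMonoidAlgebra 𝕜 S) rs ∧ 2 ≤ rs.length) ∧
      ¬ ∃ rs : List (AddMonoidAlgebra 𝕜 S), (∀ r ∈ rs, r ∈ monomialIdeal 𝕜 S) ∧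
        RingTheory.Sequence.IsRegular (AddMonoidAlgebra 𝕜 S) rs ∧ 3 ≤ rs.length := by
  constructor
  · intro h
    constructor
    · obtain ⟨_, ⟨rs, hmem, hreg, rfl⟩, hlt⟩ := lt_sSup_iff.1
        (show (1 : ℕ∞) < depth 𝕜 S by rw [h]; norm_num)
      exact ⟨rs, hmem, hreg, by exact_mod_cast hlt⟩
    · rintro ⟨rs, hmem, hreg, hlen⟩
      have hle : (rs.length : ℕ∞) ≤ depth 𝕜 S := le_sSup ⟨rs, hmem, hreg, rfl⟩
      rw [h] at hle
      have : rs.length ≤ 2 := by exact_mod_cast hle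
      omega
  · rintro ⟨⟨rs, hmem, hreg, hlen⟩, h3⟩
    refine le_antisymm (sSup_le ?_) ?_
    · rintro _ ⟨rs, hmem, hreg, rfl⟩
      have : rs.length ≤ 2 := by
        by_contra hcon
        exact h3 ⟨rs, hmem, hreg, by omega⟩
      exact_mod_cast this
    · exact le_trans (by exact_mod_cast hlen) (le_sSup ⟨rs, hmem, hreg, rfl⟩)

/-- An element of `S` that can be added to `b` without leaving `Ap S (E i) ∩ Ap S (E j)` lies in
none of the four sets `E u + S`. -/
lemma hasMaximal_of_condOne_or_condTwo (hpt : ∀ s ∈ S, -s ∈ S → s = 0) {E : Fin 4 → Fin d → ℤ}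
    (hfin : {s | s ∈ S ∧ ∀ i, s - E i ∉ S}.Finite) {i j k l : Fin 4}
    (hijkl : ({i, j, k, l} : Finset (Fin 4)) = Finset.univ) {b : Fin d → ℤ}
    (h : CondOne S E i j k l b ∨ CondTwo S E i j k l b) :
    HasMaximal S (Ap S (E i) ∩ Ap S (E j)) := by
  have hb : b ∈ Ap S (E i) ∩ Ap S (E j) := by rcases h with ⟨h, -⟩ | ⟨h, -⟩ <;> exact h
  have hl : b + E l - E i ∈ S ∨ b + E l - E j ∈ S := by
    rcases h with ⟨-, -, h⟩ | ⟨-, -, h, -⟩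
    exacts [Or.inl h, Or.inr h]
  have hk : b + E k - E i ∈ S := by rcases h with ⟨-, h, -⟩ | ⟨-, h, -⟩ <;> exact h
  refine hasMaximal_of_finite hpt hb (hfin.subset ?_)
  rintro s ⟨hs, ⟨-, hsi⟩, -, hsj⟩
  refine ⟨hs, fun u hu => ?_⟩
  have key : ∀ v, b + E u - E v ∈ S → b + s - E v ∈ S := fun v hv => by
    have := S.add_mem hv hu
    rwa [show b + E u - E v + (s - E u) = b + s - E v by abel] at this
  have hu4 := Finset.mem_univ u
  rw [← hijkl] at hu4
  simp only [Finset.mem_insert, Finset.mem_singleton] at hu4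
  rcases hu4 with rfl | rfl | rfl | rfl
  · exact hsi (key _ (by simpa using hb.1.1))
  · exact hsj (key _ (by simpa using hb.1.1))
  · exact hsi (key _ hk)
  · rcases hl with hl | hl
    · exact hsi (key _ hl)
    · exact hsj (key _ hl)

end Depth

end AffineSemigroup

theorem theorem6p4 {𝕜 : Type*} [Field 𝕜] {e : ℕ} (hde : 4 ≤ e) (a : Fin e → Fin 4 → ℕ)
    (ha : AffineSemigroup.IsSimplicialGenerators hde a)
    (S : AddSubmonoid (Fin 4 → ℤ)) (hS : S = AffineSemigroup.semigroup a)
    (E : Fin 4 → Fin 4 → ℤ)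
    (hE : E = fun i => AffineSemigroup.toInt (AffineSemigroup.extremal hde a i)) :
    (AffineSemigroup.depth 𝕜 S = 2 ↔
      (∃ c ∈ S, c ≠ 0 ∧ ¬ AffineSemigroup.HasMaximal S (AffineSemigroup.Ap S c)) ∧
      ∃ i j k l : Fin 4, ({i, j, k, l} : Finset (Fin 4)) = Finset.univ ∧ ∃ b ∈ S,
        AffineSemigroup.CondOne S E i j k l b ∨ AffineSemigroup.CondTwo S E i j k l b) ∧
    (AffineSemigroup.depth 𝕜 S = 2 ↔
      (∀ c ∈ S, c ≠ 0 → ¬ AffineSemigroup.HasMaximal S (AffineSemigroup.Ap S c)) ∧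
      ∃ i j k l : Fin 4, ({i, j, k, l} : Finset (Fin 4)) = Finset.univ ∧ ∃ b ∈ S,
        AffineSemigroup.CondOne S E i j k l b ∨ AffineSemigroup.CondTwo S E i j k l b) ∧
    ∀ i j k l : Fin 4, ({i, j, k, l} : Finset (Fin 4)) = Finset.univ → ∀ b ∈ S,
      AffineSemigroup.CondOne S E i j k l b ∨ AffineSemigroup.CondTwo S E i j k l b →
      AffineSemigroup.HasMaximal S (AffineSemigroup.Ap S (E i) ∩ AffineSemigroup.Ap S (E j)) := by
  subst hS hE
  let E : Fin 4 → AffineSemigroup.semigroup a := fun i =>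
    ⟨_, AffineSemigroup.toInt_mem_semigroup a (Fin.castLE hde i)⟩
  have hpt : ∀ s ∈ AffineSemigroup.semigroup a, -s ∈ AffineSemigroup.semigroup a → s = 0 :=
    fun s => AffineSemigroup.eq_zero_of_neg_mem_semigroup a
  have hE0 : ∀ i, E i ≠ 0 := fun i h => ha.toInt_ne_zero _ (congrArg Subtype.val h)
  have hfin := ha.finite_iInter_ap
  have := AffineSemigroup.isNoetherianRing_semigroup 𝕜 a
  have hI := AffineSemigroup.monomialIdeal_ne_top (𝕜 := 𝕜) hpt
  have hrad := AffineSemigroup.monomialIdeal_le_radical (𝕜 := 𝕜) E hfin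
  have hx : ∀ i, AddMonoidAlgebra.single (E i) (1 : 𝕜) ∈ _ := fun i =>
    AffineSemigroup.single_mem_monomialIdeal (hE0 i)
  have hdepth := AffineSemigroup.depth_eq_two_iff (𝕜 := 𝕜) (S := AffineSemigroup.semigroup a)
  have hreg := AffineSemigroup.isSMulRegular_single (𝕜 := 𝕜) (E 0)
  rw [AffineSemigroup.exists_isRegular_two_le_iff hI hrad hx (hx 0) hreg,
    AffineSemigroup.exists_isRegular_three_le_iff hI hrad hx (hx 0) hreg] at hdepth
  have hone : ∀ c ∈ AffineSemigroup.semigroup a, c ≠ 0 →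
      (AffineSemigroup.KoszulExactOne (fun i => AddMonoidAlgebra.single (E i) (1 : 𝕜))
          (AddMonoidAlgebra 𝕜 (AffineSemigroup.semigroup a)) ↔
        ¬ AffineSemigroup.HasMaximal (AffineSemigroup.semigroup a)
          (AffineSemigroup.Ap (AffineSemigroup.semigroup a) c)) := by
    intro c hc hc0
    lift c to AffineSemigroup.semigroup a using hc
    have hc0' : c ≠ 0 := fun h => hc0 (congrArg Subtype.val h)
    have hcI := hrad (AffineSemigroup.single_mem_monomialIdeal (𝕜 := 𝕜) hc0')
    have hcreg := AffineSemigroup.isSMulRegular_single (𝕜 := 𝕜) c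
    rw [← AffineSemigroup.koszulExactZero_quotSMulTop_single_iff (𝕜 := 𝕜) hpt E hE0 hfin c]
    exact ⟨(AffineSemigroup.koszulExactZero_of_isSMulRegular hcI hcreg).quotSMulTop hcreg,
      AffineSemigroup.koszulExactOne_of_quotSMulTop hcI hcreg⟩
  have htwo : ¬ AffineSemigroup.KoszulExactTwo (fun i => AddMonoidAlgebra.single (E i) (1 : 𝕜))
      (AddMonoidAlgebra 𝕜 (AffineSemigroup.semigroup a)) ↔ _ :=
    Iff.trans ⟨fun h => by_contra fun h' =>
      h (AffineSemigroup.koszulExactTwo_of_not_hasDegreeTwoClass h'),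
      AffineSemigroup.HasDegreeTwoClass.not_koszulExactTwo⟩
      (AffineSemigroup.hasDegreeTwoClass_iff (𝕜 := 𝕜) E)
  have hE00 : (E 0 : Fin 4 → ℤ) ≠ 0 := fun h => hE0 0 (Subtype.ext h)
  refine ⟨?_, ?_, fun i j k l hijkl b _ h =>
    AffineSemigroup.hasMaximal_of_condOne_or_condTwo hpt hfin hijkl h⟩
  · rw [hdepth]
    constructor
    · rintro ⟨h1, h2⟩
      exact ⟨⟨E 0, (E 0).2, hE00, (hone _ (E 0).2 hE00).1 h1⟩,
        htwo.1 fun h => h2 ⟨h1, h⟩⟩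
    · rintro ⟨⟨c, hc, hc0, h1⟩, h2⟩
      exact ⟨(hone c hc hc0).2 h1, fun h => htwo.2 h2 h.2⟩
  · rw [hdepth]
    constructor
    · rintro ⟨h1, h2⟩
      exact ⟨fun c hc hc0 => (hone c hc hc0).1 h1, htwo.1 fun h => h2 ⟨h1, h⟩⟩
    · rintro ⟨h1, h2⟩
      exact ⟨(hone _ (E 0).2 hE00).2 (h1 _ (E 0).2 hE00), fun h => htwo.2 h2 h.2⟩
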